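/- Let $n\ge 1$ and let $H_{n,+,1}$ denote the set of density matrices, i.e. positive semidefinite matrices in $\mathbb C^{n\times n}$ of trace $1$. Let $Q:\mathbb C^{n\times n}\to\mathbb C^{n\times n}$, $Q(X)=\sum_{i=1}^k A_iXA_i^*$, be a quantum channel, i.e. $A_1,\dots,A_k\in\mathbb C^{n\times n}$ and $\sum_{i=1}^k A_i^*A_i=I_n$, and suppose that $Q$ is positive, i.e. $Q(X)$ is positive definite for every $X\in H_{n,+,1}$. Let $Q'(X)=\sum_{i=1}^k A_i^*XA_i$ be its dual and put $$\tilde Q(X)=\frac{1}{\operatorname{tr}Q'(X)}\,Q'(X)\quad (X\in H_{n,+,1}).$$ For $\alpha\in H_{n,+,1}$ and positive definite $X$ put $$D_\alpha(X)=\frac{1}{\operatorname{tr}(X^{-1}\alpha)}\,X^{-1/2}\alpha X^{-1/2}.$$ Let $\alpha,\beta\in H_{n,+,1}$. Then $\Phi_{\alpha,\beta}=D_\alpha\circ\tilde Q\circ D_\beta\circ Q$ is a continuous map of $H_{n,+,1}$ into itself, and it has a fixed point in $H_{n,+,1}$. If $\alpha$ is positive definite, then every fixed point of $\Phi_{\alpha,\beta}$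 in $H_{n,+,1}$ is positive definite. -/

import Mathlib

open scoped Matrix MatrixOrder ComplexOrder

noncomputable section

namespace QuantumScaling

/-- The density matrices: positive semidefinite complex `n × n` matrices of trace `1`. -/
def densityMatrices (n : ℕ) : Set (Matrix (Fin n) (Fin n) ℂ) :=
  {X | X.PosSemidef ∧ X.trace = 1}

/-- The completely positive operator `Q(X) = ∑ i, A i * X * (A i)ᴴ` given by `A 0, …, A (k - 1)`. -/
def cpMap {n k : ℕ} (A : Fin k → Matrix (Fin n) (Fin n) ℂ) (X : Matrix (Fin n) (Fin n) ℂ) :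
    Matrix (Fin n) (Fin n) ℂ :=
  ∑ i, A i * X * (A i)ᴴ

/-- The dual operator `Q'(X) = ∑ i, (A i)ᴴ * X * A i`, for the inner product `tr (X * Yᴴ)`. -/
def dualMap {n k : ℕ} (A : Fin k → Matrix (Fin n) (Fin n) ℂ) (X : Matrix (Fin n) (Fin n) ℂ) :
    Matrix (Fin n) (Fin n) ℂ :=
  ∑ i, (A i)ᴴ * X * A i

/-- The completely positive operator given by `A` is a quantum channel (it preserves the trace). -/
def IsQuantumChannel {n k : ℕ} (A : Fin k → Matrix (Fin n) (Fin n) ℂ) : Prop :=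
  ∑ i, (A i)ᴴ * A i = 1

/-- The completely positive operator given by `A` is positive: it maps every density matrix to
a positive definite matrix. -/
def IsPositive {n k : ℕ} (A : Fin k → Matrix (Fin n) (Fin n) ℂ) : Prop :=
  ∀ X ∈ densityMatrices n, (cpMap A X).PosDef

/-- The normalized dual `X ↦ Q'(X) / tr Q'(X)`; meant for density matrices `X`. -/
def normalizedDual {n k : ℕ} (A : Fin k → Matrix (Fin n) (Fin n) ℂ)
    (X : Matrix (Fin n) (Fin n) ℂ) : Matrix (Fin n) (Fin n) ℂ :=
  (1 / (dualMap A X).trace) • dualMap A X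

/-- `D_α(X) = X^{-1/2} α X^{-1/2} / tr (X⁻¹ α)`; meant for positive definite `X`.
Here `CFC.sqrt X` is the positive semidefinite square root of `X`. -/
def scalingMap {n : ℕ} (α X : Matrix (Fin n) (Fin n) ℂ) : Matrix (Fin n) (Fin n) ℂ :=
  (1 / (X⁻¹ * α).trace) • ((CFC.sqrt X)⁻¹ * α * (CFC.sqrt X)⁻¹)

/-- `Φ_{α,β} = D_α ∘ Q̃ ∘ D_β ∘ Q`, where `Q̃` is the normalized dual of `Q`. -/
def bridgeMap {n k : ℕ} (A : Fin k → Matrix (Fin n) (Fin n) ℂ)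
    (α β : Matrix (Fin n) (Fin n) ℂ) :
    Matrix (Fin n) (Fin n) ℂ → Matrix (Fin n) (Fin n) ℂ :=
  scalingMap α ∘ normalizedDual A ∘ scalingMap β ∘ cpMap A

end QuantumScaling

end

/-!
Positivity of `Q` passes to its dual by duality of the trace form, so every intermediate value of
`Φ = D_α ∘ Q̃ ∘ D_β ∘ Q` stays where the next factor is defined and continuous. Hence `Φ` is a
continuous self-map of the compact convex set of density matrices, and Brouwer's fixed point theorem
applies; the last factor `D_α` produces positive definite matrices as soon as `α` is one.

Brouwer's theorem is obtained analytically, following Milnor and Rogers. If `g` is Lipschitz on an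
open bounded set `s` and vanishes on its frontier, then `∫ₛ det (1 + t • Dg)` is a polynomial in
`t`. For small `t` the map `x ↦ x + t • g x` permutes `s`, so the integral is the volume of `s`;
therefore it is the volume for `t = 1` as well. A `C¹` retraction of a ball onto its boundary sphere
would have a singular derivative everywhere, contradicting this for `g = f - id`.
-/

namespace Brouwer

open MeasureTheory Metric Set Module
open scoped NNReal RealInnerProductSpace Polynomial Topology

theorem inter_frontier_nonempty {X : Type*} [TopologicalSpace X] {s t : Set X}
    (ht : IsPreconnected t) (hs : (t ∩ s).Nonempty) (hsc : (t ∩ sᶜ).Nonempty) :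
    (t ∩ frontier s).Nonempty := by
  by_contra hempty
  have hmem : ∀ x ∈ t, x ∈ closure s → x ∈ interior s := fun x hxt hxs => by
    by_contra hxi
    exact hempty ⟨x, hxt, hxs, hxi⟩
  obtain ⟨x, hxt, hxs⟩ := hs
  obtain ⟨y, hyt, hys⟩ := hsc
  obtain ⟨z, -, hzs, hzc⟩ := ht (interior s) (closure s)ᶜ isOpen_interior
    isClosed_closure.isOpen_compl (fun z hz => (em (z ∈ closure s)).imp (hmem z hz) id)
    ⟨x, hxt, hmem x hxt (subset_closure hxs)⟩
    ⟨y, hyt, fun hy => hys (interior_subset (hmem y hyt hy))⟩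
  exact hzc (interior_subset_closure hzs)

section Perturbation

variable {E : Type*} [NormedAddCommGroup E]

theorem lipschitzWith_indicator [NormedSpace ℝ E] {F : Type*} [SeminormedAddCommGroup F] {K : ℝ≥0}
    {s : Set E} {g : E → F} (hg : LipschitzOnWith K g (closure s))
    (hzero : ∀ x ∈ frontier s, g x = 0) : LipschitzWith K (s.indicator g) := by
  -- A segment from a point of `s` to a point outside crosses the frontier, where `g` vanishes.
  have dist_zero_le : ∀ x ∈ s, ∀ y ∉ s, dist (g x) 0 ≤ K * dist x y := by
    intro x hx y hy
    obtain ⟨z, hzxy, hz⟩ : (segment ℝ x y ∩ frontier s).Nonempty :=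
      inter_frontier_nonempty (convex_segment x y).isPreconnected
        ⟨x, left_mem_segment ℝ x y, hx⟩ ⟨y, right_mem_segment ℝ x y, hy⟩
    calc dist (g x) 0 = dist (g x) (g z) := by rw [hzero z hz]
      _ ≤ K * dist x z :=
        hg.dist_le_mul x (subset_closure hx) z (frontier_subset_closure hz)
      _ ≤ K * dist x y := by
        gcongr
        linarith [dist_add_dist_of_mem_segment hzxy, dist_nonneg (x := z) (y := y)]
  refine LipschitzWith.of_dist_le_mul fun x y => ?_
  by_cases hx : x ∈ s <;> by_cases hy : y ∈ s
  · simpa only [indicator_of_mem hx, indicator_of_mem hy] using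
      hg.dist_le_mul x (subset_closure hx) y (subset_closure hy)
  · simpa only [indicator_of_mem hx, indicator_of_notMem hy] using dist_zero_le x hx y hy
  · simpa only [indicator_of_notMem hx, indicator_of_mem hy, dist_comm] using dist_zero_le y hy x hx
  · simpa only [indicator_of_notMem hx, indicator_of_notMem hy, dist_self] using by positivity

theorem bijective_id_add [CompleteSpace E] {K : ℝ≥0} (hK : K < 1) {h : E → E}
    (hh : LipschitzWith K h) : Function.Bijective fun x => x + h x := by
  refine (Function.bijective_iff_existsUnique _).2 fun y => ?_
  have hcontr : ContractingWith K fun x => y - h x :=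
    ⟨hK, by simpa only [zero_add] using (LipschitzWith.const y).sub hh⟩
  refine ⟨hcontr.fixedPoint, ?_, fun x hx => hcontr.fixedPoint_unique (eq_sub_of_add_eq hx).symm⟩
  exact (eq_sub_iff_add_eq.1 hcontr.fixedPoint_isFixedPt.symm)

theorem bijOn_id_add [NormedSpace ℝ E] [CompleteSpace E] {K : ℝ≥0} (hK : K < 1) {s : Set E}
    {g : E → E} (hg : LipschitzOnWith K g (closure s)) (hzero : ∀ x ∈ frontier s, g x = 0) :
    BijOn (fun x => x + g x) s s := by
  let F : E → E := fun x => x + s.indicator g x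
  have hF : Function.Bijective F := bijective_id_add hK (lipschitzWith_indicator hg hzero)
  have himage_compl : F '' sᶜ = sᶜ := by
    rw [image_congr (g := id) fun x hx => by simp only [F, indicator_of_notMem hx, add_zero, id],
      image_id]
  have himage : F '' s = s := by
    rwa [image_compl_eq hF, compl_inj_iff] at himage_compl
  refine BijOn.congr (f₁ := F) ?_ fun x hx => by simp only [F, indicator_of_mem hx]
  simpa only [himage] using hF.injective.injOn.bijOn_image (s := s)

variable [NormedSpace ℝ E] [FiniteDimensional ℝ E]

theorem det_one_add_pos {A : E →L[ℝ] E} (hA : ‖A‖ < 1) : 0 < (1 + A).det := by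
  have hne : ∀ t ∈ Icc (0 : ℝ) 1, (1 + t • A).det ≠ 0 := by
    intro t ht
    have hlt : ‖-(t • A)‖ < 1 := by
      rw [norm_neg, norm_smul, Real.norm_of_nonneg ht.1]
      exact (mul_le_of_le_one_left (norm_nonneg A) ht.2).trans_lt hA
    have hunit : IsUnit (1 + t • A) := by
      simpa only [sub_neg_eq_add] using isUnit_one_sub_of_norm_lt_one hlt
    exact ((hunit.map ContinuousLinearMap.toLinearMapRingHom).map LinearMap.det).ne_zero
  have hcont : Continuous fun t : ℝ => (1 + t • A).det :=
    ContinuousLinearMap.continuous_det.comp (by fun_prop)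
  by_contra! hle
  obtain ⟨t, ht, hzero⟩ := intermediate_value_Icc' zero_le_one hcont.continuousOn
    (show (0 : ℝ) ∈ Icc _ _ by
      simpa [ContinuousLinearMap.det] using hle)
  exact hne t ht hzero

variable [MeasurableSpace E] [BorelSpace E] (μ : Measure E) [μ.IsAddHaarMeasure]

theorem integral_det_one_add_fderiv_of_lt_one {K : ℝ≥0} (hK : K < 1) {s : Set E} (hs : IsOpen s)
    {g : E → E} (hg : LipschitzOnWith K g (closure s)) (hdiff : DifferentiableOn ℝ g s)
    (hzero : ∀ x ∈ frontier s, g x = 0) :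
    ∫ x in s, (1 + fderiv ℝ g x).det ∂μ = μ.real s := by
  have hbij := bijOn_id_add hK hg hzero
  have hderiv : ∀ x ∈ s, HasFDerivWithinAt (fun x => x + g x) (1 + fderiv ℝ g x) s x :=
    fun x hx => ((hasFDerivAt_id x).add
      (hdiff.differentiableAt (hs.mem_nhds hx)).hasFDerivAt).hasFDerivWithinAt
  have hpos : ∀ x ∈ s, 0 < (1 + fderiv ℝ g x).det := fun x hx =>
    det_one_add_pos <| (norm_fderiv_le_of_lipschitzOn ℝ (hs.mem_nhds hx)
      (hg.mono subset_closure)).trans_lt (NNReal.coe_lt_one.2 hK)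
  calc ∫ x in s, (1 + fderiv ℝ g x).det ∂μ
      = ∫ x in s, |(1 + fderiv ℝ g x).det| • (1 : ℝ) ∂μ :=
        setIntegral_congr_fun hs.measurableSet fun x hx => by
          simp only [abs_of_pos (hpos x hx), smul_eq_mul, mul_one]
    _ = ∫ _ in (fun x => x + g x) '' s, (1 : ℝ) ∂μ :=
        (integral_image_eq_integral_abs_det_fderiv_smul μ hs.measurableSet hderiv hbij.injOn
          fun _ => 1).symm
    _ = μ.real s := by rw [hbij.image_eq, setIntegral_const, smul_eq_mul, mul_one]

end Perturbation

section PolynomialIntegral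

theorem exists_polynomial_eval_eq_integral {α : Type*} [MeasurableSpace α] {μ : Measure α}
    {p : α → ℝ[X]} {d : ℕ} (hdeg : ∀ a, (p a).natDegree ≤ d)
    (hint : ∀ t, Integrable (fun a => (p a).eval t) μ) :
    ∃ q : ℝ[X], ∀ t, q.eval t = ∫ a, (p a).eval t ∂μ := by
  let ℓ : ℕ → ℝ[X] := Lagrange.basis (Finset.range (d + 1)) ((↑) : ℕ → ℝ)
  have heval : ∀ a t, (p a).eval t = ∑ i ∈ Finset.range (d + 1), (p a).eval ↑i * (ℓ i).eval t := by
    intro a t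
    have hinterp := Lagrange.eq_interpolate (s := Finset.range (d + 1)) (v := ((↑) : ℕ → ℝ))
      (f := p a) Nat.cast_injective.injOn <| by
        rw [Finset.card_range]
        exact Polynomial.degree_le_natDegree.trans_lt (by exact_mod_cast Nat.lt_succ_of_le (hdeg a))
    conv_lhs => rw [hinterp]
    simp only [Lagrange.interpolate_apply, Polynomial.eval_finsetSum, Polynomial.eval_mul,
      Polynomial.eval_C, ℓ]
  refine ⟨∑ i ∈ Finset.range (d + 1), Polynomial.C (∫ a, (p a).eval ↑i ∂μ) * ℓ i, fun t => ?_⟩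
  rw [integral_congr_ae (ae_of_all μ fun a => heval a t),
    integral_finsetSum (f := fun i a => (p a).eval ↑i * (ℓ i).eval t) _
      fun i _ => (hint i).mul_const _]
  simp only [Polynomial.eval_finsetSum, Polynomial.eval_mul, Polynomial.eval_C, integral_mul_const]

theorem exists_polynomial_eval_eq_det_one_add_smul {V : Type*} [AddCommGroup V] [Module ℝ V]
    [FiniteDimensional ℝ V] (M : V →ₗ[ℝ] V) :
    ∃ p : ℝ[X], p.natDegree ≤ finrank ℝ V ∧ ∀ t, p.eval t = LinearMap.det (1 + t • M) := by
  let b := finBasis ℝ V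
  let B := LinearMap.toMatrix b b M
  let P : Matrix (Fin (finrank ℝ V)) (Fin (finrank ℝ V)) ℝ[X] :=
    (Polynomial.X : ℝ[X]) • B.map Polynomial.C + (1 : Matrix _ _ ℝ).map Polynomial.C
  refine ⟨P.det, by simpa only [Fintype.card_fin] using Polynomial.natDegree_det_X_add_C_le B 1,
    fun t => ?_⟩
  have hP : P.map (Polynomial.eval t) = 1 + t • B := by
    ext i j
    simp only [P, Matrix.map_apply, Matrix.add_apply, Matrix.smul_apply, smul_eq_mul,
      Polynomial.eval_add, Polynomial.eval_mul, Polynomial.eval_X, Polynomial.eval_C, add_comm]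
  rw [← LinearMap.det_toMatrix b, ← Polynomial.coe_evalRingHom, RingHom.map_det]
  simp only [map_add, map_smul, LinearMap.toMatrix_one]
  exact congrArg Matrix.det hP

end PolynomialIntegral

section NullLagrangian

variable {E : Type*} [NormedAddCommGroup E] [NormedSpace ℝ E] [FiniteDimensional ℝ E]
  [MeasurableSpace E] [BorelSpace E]

theorem integrableOn_comp_fderiv {μ : Measure E} [IsFiniteMeasureOnCompacts μ]
    {F : Type*} [NormedAddCommGroup F] {Φ : (E →L[ℝ] E) → F} (hΦ : Continuous Φ) {K : ℝ≥0}
    {s : Set E} (hs : IsOpen s) (hbdd : Bornology.IsBounded s) {g : E → E}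
    (hg : LipschitzOnWith K g s) : IntegrableOn (fun x => Φ (fderiv ℝ g x)) s μ := by
  obtain ⟨C, hC⟩ := (isCompact_closedBall (0 : E →L[ℝ] E) K).exists_bound_of_continuousOn
    hΦ.continuousOn
  refine Measure.integrableOn_of_bounded (M := C) hbdd.measure_lt_top.ne
    (hΦ.comp_aestronglyMeasurable (measurable_fderiv ℝ g).aestronglyMeasurable) ?_
  filter_upwards [ae_restrict_mem hs.measurableSet] with x hx
  exact hC _ (mem_closedBall_zero_iff.2 (norm_fderiv_le_of_lipschitzOn ℝ (hs.mem_nhds hx) hg))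

theorem integral_det_one_add_fderiv (μ : Measure E) [μ.IsAddHaarMeasure] {K : ℝ≥0} {s : Set E}
    (hs : IsOpen s) (hbdd : Bornology.IsBounded s) {g : E → E}
    (hg : LipschitzOnWith K g (closure s)) (hdiff : DifferentiableOn ℝ g s)
    (hzero : ∀ x ∈ frontier s, g x = 0) :
    ∫ x in s, (1 + fderiv ℝ g x).det ∂μ = μ.real s := by
  choose p hdeg hp using fun x =>
    exists_polynomial_eval_eq_det_one_add_smul (fderiv ℝ g x : E →ₗ[ℝ] E)
  have hp' : ∀ x t, (p x).eval t = (1 + t • fderiv ℝ g x).det := hp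
  obtain ⟨q, hq⟩ := exists_polynomial_eval_eq_integral (μ := μ.restrict s) hdeg fun t => by
    simp only [hp']
    exact integrableOn_comp_fderiv (μ := μ) (Φ := fun A => (1 + t • A).det)
      (ContinuousLinearMap.continuous_det.comp (by fun_prop)) hs hbdd (hg.mono subset_closure)
  have hsmall : ∀ t : ℝ, ‖t‖₊ * K < 1 → q.eval t = μ.real s := fun t ht => by
    rw [hq, ← integral_det_one_add_fderiv_of_lt_one μ ht hs (g := fun x => t • g x)
      ((lipschitzWith_smul t).comp_lipschitzOnWith hg) (hdiff.const_smul t)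
      fun x hx => by rw [hzero x hx, smul_zero]]
    refine setIntegral_congr_fun hs.measurableSet fun x hx => ?_
    simp only [hp', fderiv_fun_const_smul (hdiff.differentiableAt (hs.mem_nhds hx))]
  have hq_const : q = Polynomial.C (μ.real s) := by
    have hnhds : {t : ℝ | ‖t‖₊ * K < 1} ∈ 𝓝 0 :=
      (isOpen_lt (by fun_prop) continuous_const).mem_nhds (by simp)
    refine Polynomial.eq_of_infinite_eval_eq _ _
      ((infinite_of_mem_nhds 0 hnhds).mono fun t ht => ?_)
    simpa only [mem_ofPred_eq, Polynomial.eval_C] using hsmall t ht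
  simpa only [hp', one_smul, hq_const, Polynomial.eval_C] using (hq 1).symm

end NullLagrangian

theorem exists_det_fderiv_ne_zero {E : Type*} [NormedAddCommGroup E] [NormedSpace ℝ E]
    [FiniteDimensional ℝ E] {K : ℝ≥0} {s : Set E} (hs : IsOpen s) (hbdd : Bornology.IsBounded s)
    (hne : s.Nonempty) {f : E → E} (hf : LipschitzOnWith K f (closure s))
    (hdiff : DifferentiableOn ℝ f s) (hfix : ∀ x ∈ frontier s, f x = x) :
    ∃ x ∈ s, (fderiv ℝ f x).det ≠ 0 := by
  by_contra! hdet
  borelize E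
  let μ : Measure E := Measure.addHaar
  have hvol : 0 < μ.real s := ENNReal.toReal_pos (hs.measure_pos μ hne).ne' hbdd.measure_lt_top.ne
  have hintegral := integral_det_one_add_fderiv μ hs hbdd (g := fun x => f x - x)
    (hf.sub LipschitzWith.id.lipschitzOnWith) (hdiff.sub differentiableOn_id)
    fun x hx => by rw [hfix x hx, sub_self]
  rw [← hintegral, setIntegral_congr_fun (g := fun _ => (0 : ℝ)) hs.measurableSet fun x hx => ?_,
    integral_zero] at hvol
  · exact hvol.false
  · have hsub : fderiv ℝ (fun x => f x - x) x = fderiv ℝ f x - 1 :=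
      ((hdiff.differentiableAt (hs.mem_nhds hx)).hasFDerivAt.sub (hasFDerivAt_id x)).fderiv
    simp only [hsub, add_sub_cancel, hdet x hx]

section InnerProductSpace

variable {E : Type*} [NormedAddCommGroup E] [InnerProductSpace ℝ E]

theorem inner_fderiv_eq_zero_of_norm_eq {F : Type*} [NormedAddCommGroup F] [NormedSpace ℝ F]
    {f : F → E} {x : F} (hf : DifferentiableAt ℝ f x) (hnorm : ∀ᶠ y in 𝓝 x, ‖f y‖ = ‖f x‖)
    (w : F) : ⟪f x, fderiv ℝ f x w⟫ = 0 := by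
  have hconst : fderiv ℝ (fun y => ‖f y‖ ^ 2) x = 0 := by
    refine (Filter.EventuallyEq.fderiv_eq ?_).trans (fderiv_const_apply (‖f x‖ ^ 2))
    filter_upwards [hnorm] with y hy using by rw [hy]
  simpa using DFunLike.congr_fun (hf.hasFDerivAt.norm_sq.fderiv.symm.trans hconst) w

theorem det_fderiv_eq_zero_of_norm_eq [FiniteDimensional ℝ E] {f : E → E} {x : E}
    (hf : DifferentiableAt ℝ f x) (hx : f x ≠ 0) (hnorm : ∀ᶠ y in 𝓝 x, ‖f y‖ = ‖f x‖) :
    (fderiv ℝ f x).det = 0 := by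
  by_contra hdet
  obtain ⟨w, hw⟩ : ∃ w, fderiv ℝ f x w = f x :=
    (LinearMap.equivOfDetNeZero _ hdet).surjective (f x)
  have horth := inner_fderiv_eq_zero_of_norm_eq hf hnorm w
  rw [hw] at horth
  exact hx (inner_self_eq_zero.1 horth)

theorem exists_contDiff_ne_zero_eq_id [FiniteDimensional ℝ E] {r : ℝ} (hr : 0 < r)
    {h : E → E} (hh : ContDiff ℝ 1 h) (hbdd : ∀ x, ‖h x‖ ≤ r) (hne : ∀ x, h x ≠ x) :
    ∃ v : E → E, ContDiff ℝ 1 v ∧ (∀ x, v x ≠ 0) ∧ ∀ x, r + 1 ≤ ‖x‖ → v x = x := by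
  let φ : ContDiffBump (0 : E) := ⟨r, r + 1, hr, lt_add_one r⟩
  refine ⟨fun x => x - φ x • h x, contDiff_id.sub (φ.contDiff.smul hh), fun x hx => ?_,
    fun x hx => ?_⟩
  · have hx_eq : x = φ x • h x := sub_eq_zero.1 hx
    have hnorm : ‖x‖ ≤ r := by
      rw [hx_eq, norm_smul, Real.norm_of_nonneg φ.nonneg]
      exact (mul_le_of_le_one_left (norm_nonneg _) φ.le_one).trans (hbdd x)
    rw [φ.one_of_mem_closedBall (mem_closedBall_zero_iff.2 hnorm), one_smul] at hx_eq
    exact hne x hx_eq.symm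
  · beta_reduce
    rw [φ.zero_of_le_dist (by simpa only [dist_zero_right] using hx), zero_smul, sub_zero]

theorem not_contDiff_of_norm_eq_of_fixes_sphere [FiniteDimensional ℝ E] {R : ℝ} (hR : 0 < R)
    {f : E → E} (hnorm : ∀ x, ‖f x‖ = R) (hfix : ∀ x ∈ sphere (0 : E) R, f x = x) :
    ¬ ContDiff ℝ 1 f := by
  intro hf
  have hdiff : Differentiable ℝ f := hf.differentiable one_ne_zero
  obtain ⟨K, hK⟩ := hf.contDiffOn.exists_lipschitzOnWith one_ne_zero
    (convex_closedBall (0 : E) R) (isCompact_closedBall 0 R)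
  obtain ⟨x, -, hx⟩ := exists_det_fderiv_ne_zero isOpen_ball isBounded_ball (nonempty_ball.2 hR)
    (by rwa [closure_ball _ hR.ne']) hdiff.differentiableOn (by rwa [frontier_ball _ hR.ne'])
  exact hx <| det_fderiv_eq_zero_of_norm_eq (hdiff x) (norm_pos_iff.1 (by rwa [hnorm]))
    (.of_forall fun y => by rw [hnorm, hnorm])

theorem exists_fixedPoint_of_contDiff_of_bounded [FiniteDimensional ℝ E] {r : ℝ} {h : E → E}
    (hh : ContDiff ℝ 1 h) (hbdd : ∀ x, ‖h x‖ ≤ r) : ∃ x, h x = x := by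
  by_contra! hne
  have hr : 0 ≤ r := (norm_nonneg _).trans (hbdd 0)
  obtain ⟨v, hv, hv0, hvid⟩ := exists_contDiff_ne_zero_eq_id (r := r + 1) (by positivity) hh
    (fun x => (hbdd x).trans (le_add_of_nonneg_right zero_le_one)) hne
  refine not_contDiff_of_norm_eq_of_fixes_sphere (R := r + 1 + 1) (by positivity)
    (f := fun x => ((r + 1 + 1) / ‖v x‖) • v x) (fun x => ?_) (fun x hx => ?_)
    ((contDiff_const.div (hv.norm ℝ hv0) fun x => norm_ne_zero_iff.2 (hv0 x)).smul hv)
  · rw [norm_smul, norm_div, norm_norm, div_mul_cancel₀ _ (norm_ne_zero_iff.2 (hv0 x)),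
      Real.norm_of_nonneg (by positivity)]
  · have hx' := mem_sphere_zero_iff_norm.1 hx
    simp only [hvid x hx'.ge]
    rw [hx', div_self (by positivity), one_smul]

theorem exists_lipschitzWith_one_retraction {C : Set E} (hne : C.Nonempty) (hC : IsComplete C)
    (hconv : Convex ℝ C) :
    ∃ p : E → E, LipschitzWith 1 p ∧ (∀ x, p x ∈ C) ∧ ∀ x ∈ C, p x = x := by
  choose p hpC hpmin using exists_norm_eq_iInf_of_complete_convex hne hC hconv
  have hobtuse : ∀ x, ∀ w ∈ C, ⟪x - p x, w - p x⟫ ≤ 0 := fun x =>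
    (norm_eq_iInf_iff_real_inner_le_zero hconv (hpC x)).1 (hpmin x)
  refine ⟨p, LipschitzWith.of_dist_le_mul fun x y => ?_, hpC, fun x hx => ?_⟩
  · have hinner : ‖p x - p y‖ ^ 2 ≤ ⟪x - y, p x - p y⟫ := by
      have hx := hobtuse x _ (hpC y)
      have hy := hobtuse y _ (hpC x)
      rw [← real_inner_self_eq_norm_sq]
      simp only [inner_sub_left, inner_sub_right] at hx hy ⊢
      linarith
    rw [NNReal.coe_one, one_mul, dist_eq_norm, dist_eq_norm]
    by_contra! hlt
    nlinarith [real_inner_le_norm (x - y) (p x - p y), norm_nonneg (x - y)]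
  · have hself := hobtuse x x hx
    rw [real_inner_self_nonpos, sub_eq_zero] at hself
    exact hself.symm

theorem exists_fixedPoint_of_continuous_of_bounded [FiniteDimensional ℝ E] {r : ℝ} {f : E → E}
    (hf : Continuous f) (hbdd : ∀ x, ‖f x‖ ≤ r) : ∃ x, f x = x := by
  by_contra! hne
  obtain ⟨h, hh, happrox, -⟩ := hf.exists_contDiff_approx 1
    (ε := fun x => min 1 (dist (f x) x)) (by fun_prop)
    fun x => lt_min one_pos (dist_pos.2 (hne x))
  obtain ⟨x, hx⟩ := exists_fixedPoint_of_contDiff_of_bounded (r := r + 1) hh fun x => by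
    have hdist := (happrox x).trans_le (min_le_left _ _)
    rw [dist_eq_norm] at hdist
    linarith [norm_le_norm_add_norm_sub' (h x) (f x), hbdd x]
  have hlt := (happrox x).trans_le (min_le_right _ _)
  rw [hx, dist_comm] at hlt
  exact hlt.false

theorem exists_fixedPoint_of_convex_isCompact_of_innerProductSpace [FiniteDimensional ℝ E]
    {C : Set E} (hconv : Convex ℝ C) (hC : IsCompact C) (hne : C.Nonempty) {f : E → E}
    (hf : ContinuousOn f C) (hmaps : MapsTo f C C) : ∃ x ∈ C, f x = x := by
  obtain ⟨p, hp, hpC, hpid⟩ := exists_lipschitzWith_one_retraction hne hC.isComplete hconv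
  obtain ⟨r, hr⟩ := hC.isBounded.exists_norm_le
  obtain ⟨x, hx⟩ := exists_fixedPoint_of_continuous_of_bounded (f := f ∘ p)
    (hf.comp_continuous hp.continuous hpC) fun x => hr _ (hmaps (hpC x))
  have hxC : x ∈ C := hx ▸ hmaps (hpC x)
  exact ⟨x, hxC, by rwa [Function.comp_apply, hpid x hxC] at hx⟩

end InnerProductSpace

theorem exists_fixedPoint_of_convex_isCompact {E : Type*} [AddCommGroup E] [TopologicalSpace E]
    [IsTopologicalAddGroup E] [T2Space E] [Module ℝ E] [ContinuousSMul ℝ E]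
    [FiniteDimensional ℝ E] {C : Set E} (hconv : Convex ℝ C) (hC : IsCompact C)
    (hne : C.Nonempty) {f : E → E} (hf : ContinuousOn f C) (hmaps : MapsTo f C C) :
    ∃ x ∈ C, f x = x := by
  let e : E ≃L[ℝ] EuclideanSpace ℝ (Fin (finrank ℝ E)) := toEuclidean
  have hsymm : MapsTo e.symm (e '' C) C := by
    rintro _ ⟨x, hx, rfl⟩
    rwa [e.symm_apply_apply]
  obtain ⟨_, ⟨x, hx, rfl⟩, hfix⟩ := exists_fixedPoint_of_convex_isCompact_of_innerProductSpace
    (C := e '' C) (f := e ∘ f ∘ e.symm) (hconv.linear_image e.toLinearEquiv.toLinearMap)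
    (hC.image e.continuous) (hne.image e)
    (e.continuous.comp_continuousOn (hf.comp e.symm.continuous.continuousOn hsymm))
    fun y hy => mem_image_of_mem e (hmaps (hsymm hy))
  exact ⟨x, hx, by simpa only [Function.comp_apply, e.symm_apply_apply, e.injective.eq_iff]
    using hfix⟩

end Brouwer

namespace QuantumScaling

section PosDef

variable {m 𝕜 : Type*} [Fintype m] [RCLike 𝕜] {X Y : Matrix m m 𝕜}

theorem trace_pos_of_posSemidef (hX : X.PosSemidef) (h0 : X ≠ 0) : 0 < X.trace :=
  hX.trace_nonneg.lt_of_ne' (hX.trace_eq_zero_iff.not.2 h0)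

open scoped Classical in
theorem posDef_sqrt (hY : Y.PosDef) : (CFC.sqrt Y).PosDef :=
  Matrix.isStrictlyPositive_iff_posDef.1 (hY.isStrictlyPositive.sqrt Y)

open scoped Classical Matrix.Norms.L2Operator in
theorem continuousOn_sqrt_posDef :
    ContinuousOn (CFC.sqrt : Matrix m m ℂ → Matrix m m ℂ) {Y | Y.PosDef} :=
  (CFC.continuousOn_sqrt (A := Matrix m m ℂ)).mono fun _ hY =>
    (Matrix.PosDef.posSemidef hY).nonneg

variable [DecidableEq m]

theorem posSemidef_conj_inv_sqrt (hX : X.PosSemidef) (hY : Y.PosDef) :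
    ((CFC.sqrt Y)⁻¹ * X * (CFC.sqrt Y)⁻¹).PosSemidef := by
  have hsqrt := posDef_sqrt hY
  simpa only [hsqrt.inv.isHermitian.eq] using hX.mul_mul_conjTranspose_same (CFC.sqrt Y)⁻¹

theorem posDef_conj_inv_sqrt (hX : X.PosDef) (hY : Y.PosDef) :
    ((CFC.sqrt Y)⁻¹ * X * (CFC.sqrt Y)⁻¹).PosDef := by
  have hsqrt := (posDef_sqrt hY).inv
  have hconj := (Matrix.IsUnit.posDef_star_right_conjugate_iff hsqrt.isUnit).2 hX
  rwa [Matrix.star_eq_conjTranspose, hsqrt.isHermitian.eq] at hconj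

theorem conj_inv_sqrt_ne_zero (h0 : X ≠ 0) (hY : Y.PosDef) :
    (CFC.sqrt Y)⁻¹ * X * (CFC.sqrt Y)⁻¹ ≠ 0 := by
  have hunit := (posDef_sqrt hY).inv.isUnit
  rwa [Ne, hunit.mul_left_eq_zero, hunit.mul_right_eq_zero]

theorem trace_conj_inv_sqrt (X : Matrix m m 𝕜) (hY : Y.PosDef) :
    ((CFC.sqrt Y)⁻¹ * X * (CFC.sqrt Y)⁻¹).trace = (Y⁻¹ * X).trace := by
  rw [Matrix.trace_mul_comm, ← mul_assoc, ← Matrix.mul_inv_rev,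
    CFC.sqrt_mul_sqrt_self Y hY.posSemidef.nonneg]

theorem trace_inv_mul_pos (hX : X.PosSemidef) (h0 : X ≠ 0) (hY : Y.PosDef) :
    0 < (Y⁻¹ * X).trace := by
  rw [← trace_conj_inv_sqrt X hY]
  exact trace_pos_of_posSemidef (posSemidef_conj_inv_sqrt hX hY) (conj_inv_sqrt_ne_zero h0 hY)

theorem continuousOn_inv_posDef : ContinuousOn (fun Y : Matrix m m 𝕜 => Y⁻¹) {Y | Y.PosDef} :=
  fun Y hY => (continuousAt_matrix_inv Y <| by
    simpa only [Ring.inverse_eq_inv'] using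
      continuousAt_inv₀ (Matrix.PosDef.det_pos hY).ne').continuousWithinAt

open scoped Matrix.Norms.L2Operator in
theorem l2_opNorm_le_trace {X : Matrix m m ℂ} (hX : X.PosSemidef) : ‖X‖ ≤ X.trace.re := by
  have htrace : X.trace.re = ∑ i, hX.isHermitian.eigenvalues i := by
    rw [hX.isHermitian.trace_eq_sum_eigenvalues, Complex.re_sum]
    rfl
  have hnonneg : 0 ≤ X.trace.re := htrace ▸ Finset.sum_nonneg fun i _ => hX.eigenvalues_nonneg i
  rw [CStarAlgebra.norm_le_iff_le_algebraMap X hnonneg hX.nonneg,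
    le_algebraMap_iff_spectrum_le hX.isHermitian.isSelfAdjoint,
    hX.isHermitian.spectrum_real_eq_range_eigenvalues]
  rintro _ ⟨i, rfl⟩
  exact htrace ▸ Finset.single_le_sum (fun j _ => hX.eigenvalues_nonneg j) (Finset.mem_univ i)

end PosDef

section DensityMatrices

variable {n : ℕ}

theorem inv_trace_smul_mem_densityMatrices {X : Matrix (Fin n) (Fin n) ℂ} (hX : X.PosSemidef)
    (h0 : X ≠ 0) : (1 / X.trace) • X ∈ densityMatrices n := by
  have htrace := trace_pos_of_posSemidef hX h0
  refine ⟨hX.smul (one_div_pos.2 htrace).le, ?_⟩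
  rw [Matrix.trace_smul, smul_eq_mul, one_div_mul_cancel htrace.ne']

theorem ne_zero_of_mem_densityMatrices {X : Matrix (Fin n) (Fin n) ℂ}
    (hX : X ∈ densityMatrices n) : X ≠ 0 := by
  rintro rfl
  simpa using hX.2

theorem convex_densityMatrices : Convex ℝ (densityMatrices n) := by
  intro X hX Y hY a b ha hb hab
  refine ⟨(hX.1.smul ha).add (hY.1.smul hb), ?_⟩
  rw [Matrix.trace_add, Matrix.trace_smul, Matrix.trace_smul, hX.2, hY.2, ← add_smul, hab, one_smul]

open scoped Matrix.Norms.L2Operator in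
theorem isCompact_densityMatrices : IsCompact (densityMatrices n) := by
  have hclosed : IsClosed (densityMatrices n) := by
    have hpsd : IsClosed {X : Matrix (Fin n) (Fin n) ℂ | X.PosSemidef} := by
      simp only [← Matrix.nonneg_iff_posSemidef]
      exact isClosed_Ici
    exact hpsd.inter (isClosed_eq (by fun_prop) continuous_const)
  have : ProperSpace (Matrix (Fin n) (Fin n) ℂ) := FiniteDimensional.proper ℂ _
  refine (isCompact_closedBall 0 1).of_isClosed_subset hclosed fun X hX => ?_
  rw [mem_closedBall_zero_iff]
  simpa only [hX.2, Complex.one_re] using l2_opNorm_le_trace hX.1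

end DensityMatrices

section Channel

variable {n k : ℕ} {A : Fin k → Matrix (Fin n) (Fin n) ℂ} {α β X : Matrix (Fin n) (Fin n) ℂ}

theorem continuous_cpMap (A : Fin k → Matrix (Fin n) (Fin n) ℂ) : Continuous (cpMap A) := by
  unfold cpMap
  fun_prop

theorem continuous_dualMap (A : Fin k → Matrix (Fin n) (Fin n) ℂ) : Continuous (dualMap A) := by
  unfold dualMap
  fun_prop

theorem cpMap_smul (A : Fin k → Matrix (Fin n) (Fin n) ℂ) (c : ℂ)
    (X : Matrix (Fin n) (Fin n) ℂ) : cpMap A (c • X) = c • cpMap A X := by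
  simp only [cpMap, Matrix.mul_smul, Matrix.smul_mul, Finset.smul_sum]

theorem trace_dualMap_mul (A : Fin k → Matrix (Fin n) (Fin n) ℂ)
    (X Y : Matrix (Fin n) (Fin n) ℂ) : (dualMap A X * Y).trace = (X * cpMap A Y).trace := by
  simp only [dualMap, cpMap, Finset.sum_mul, Finset.mul_sum, Matrix.trace_sum]
  refine Finset.sum_congr rfl fun i _ => ?_
  rw [mul_assoc, mul_assoc, Matrix.trace_mul_comm]
  simp only [mul_assoc]

theorem IsPositive.cpMap_posDef (hA : IsPositive A) (hX : X.PosSemidef) (h0 : X ≠ 0) :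
    (cpMap A X).PosDef := by
  have htrace := trace_pos_of_posSemidef hX h0
  have hscaled := (hA _ (inv_trace_smul_mem_densityMatrices hX h0)).smul htrace
  rwa [← cpMap_smul, smul_smul, mul_one_div_cancel htrace.ne', one_smul] at hscaled

theorem IsPositive.dualMap_posDef (hA : IsPositive A) (hX : X.PosSemidef) (h0 : X ≠ 0) :
    (dualMap A X).PosDef := by
  have hpsd : (dualMap A X).PosSemidef :=
    Matrix.posSemidef_sum _ fun i _ => hX.conjTranspose_mul_mul_same (A i)
  refine Matrix.PosDef.of_dotProduct_mulVec_pos hpsd.isHermitian fun v hv => ?_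
  have hvv : Matrix.vecMulVec v (star v) ≠ 0 := by
    simpa only [Ne, Matrix.vecMulVec_eq_zero, star_eq_zero, or_self] using hv
  have hcp := hA.cpMap_posDef (Matrix.posSemidef_vecMulVec_self_star v) hvv
  calc star v ⬝ᵥ (dualMap A X *ᵥ v)
      = (dualMap A X * Matrix.vecMulVec v (star v)).trace := by
        rw [Matrix.mul_vecMulVec, Matrix.trace_vecMulVec, dotProduct_comm]
    _ = (X * cpMap A (Matrix.vecMulVec v (star v))).trace := trace_dualMap_mul ..
    _ = ((cpMap A (Matrix.vecMulVec v (star v)))⁻¹⁻¹ * X).trace := by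
        rw [Matrix.nonsing_inv_nonsing_inv _ hcp.det_pos.ne'.isUnit, Matrix.trace_mul_comm]
    _ > 0 := trace_inv_mul_pos hX h0 hcp.inv

theorem IsPositive.trace_dualMap_pos (hA : IsPositive A) (hX : X.PosSemidef) (h0 : X ≠ 0) :
    0 < (dualMap A X).trace := by
  have : Nonempty (Fin n) := not_isEmpty_iff.1 fun _ => h0 (Subsingleton.elim _ _)
  exact (hA.dualMap_posDef hX h0).trace_pos

theorem IsPositive.normalizedDual_posDef (hA : IsPositive A) (hX : X.PosSemidef) (h0 : X ≠ 0) :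
    (normalizedDual A X).PosDef :=
  (hA.dualMap_posDef hX h0).smul (one_div_pos.2 (hA.trace_dualMap_pos hX h0))

theorem IsPositive.continuousOn_normalizedDual (hA : IsPositive A) :
    ContinuousOn (normalizedDual A) {X | X.PosSemidef ∧ X ≠ 0} := by
  have hdual := (continuous_dualMap A).continuousOn (s := {X | X.PosSemidef ∧ X ≠ 0})
  exact (continuousOn_const.div (continuous_id.matrix_trace.comp_continuousOn hdual)
    fun X hX => (hA.trace_dualMap_pos hX.1 hX.2).ne').smul hdual

theorem scalingMap_mem_densityMatrices (hα : α.PosSemidef) (h0 : α ≠ 0) (hX : X.PosDef) :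
    scalingMap α X ∈ densityMatrices n := by
  rw [scalingMap, ← trace_conj_inv_sqrt α hX]
  exact inv_trace_smul_mem_densityMatrices (posSemidef_conj_inv_sqrt hα hX)
    (conj_inv_sqrt_ne_zero h0 hX)

theorem scalingMap_posDef (hα : α.PosDef) (hX : X.PosDef) : (scalingMap α X).PosDef := by
  obtain rfl | h0 := eq_or_ne α 0
  · simpa only [scalingMap, mul_zero, zero_mul, smul_zero] using hα
  · exact (posDef_conj_inv_sqrt hα hX).smul
      (one_div_pos.2 (trace_inv_mul_pos hα.posSemidef h0 hX))

theorem continuousOn_scalingMap (hα : α.PosSemidef) (h0 : α ≠ 0) :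
    ContinuousOn (scalingMap α) {X | X.PosDef} := by
  have hinv_sqrt : ContinuousOn (fun X : Matrix (Fin n) (Fin n) ℂ => (CFC.sqrt X)⁻¹)
      {X | X.PosDef} :=
    continuousOn_inv_posDef.comp continuousOn_sqrt_posDef fun _ => posDef_sqrt
  have htrace : ContinuousOn (fun X : Matrix (Fin n) (Fin n) ℂ => (X⁻¹ * α).trace) {X | X.PosDef} :=
    continuous_id.matrix_trace.comp_continuousOn
      (continuousOn_inv_posDef.mul continuousOn_const)
  exact (continuousOn_const.div htrace fun X hX => (trace_inv_mul_pos hα h0 hX).ne').smul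
    ((hinv_sqrt.mul continuousOn_const).mul hinv_sqrt)

end Channel

section BridgeMap

variable {n k : ℕ} {A : Fin k → Matrix (Fin n) (Fin n) ℂ} {α β U : Matrix (Fin n) (Fin n) ℂ}

theorem IsPositive.normalizedDual_scalingMap_cpMap_posDef (hA : IsPositive A) (hβ : β.PosSemidef)
    (hβ0 : β ≠ 0) (hU : U ∈ densityMatrices n) :
    (normalizedDual A (scalingMap β (cpMap A U))).PosDef := by
  have hmem := scalingMap_mem_densityMatrices hβ hβ0 (hA U hU)
  exact hA.normalizedDual_posDef hmem.1 (ne_zero_of_mem_densityMatrices hmem)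

theorem IsPositive.mapsTo_bridgeMap (hA : IsPositive A) (hα : α.PosSemidef) (hα0 : α ≠ 0)
    (hβ : β.PosSemidef) (hβ0 : β ≠ 0) :
    Set.MapsTo (bridgeMap A α β) (densityMatrices n) (densityMatrices n) := fun _ hU =>
  scalingMap_mem_densityMatrices hα hα0 (hA.normalizedDual_scalingMap_cpMap_posDef hβ hβ0 hU)

theorem IsPositive.continuousOn_bridgeMap (hA : IsPositive A) (hα : α.PosSemidef) (hα0 : α ≠ 0)
    (hβ : β.PosSemidef) (hβ0 : β ≠ 0) :
    ContinuousOn (bridgeMap A α β) (densityMatrices n) := by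
  have hscaled : ContinuousOn (scalingMap β ∘ cpMap A) (densityMatrices n) :=
    (continuousOn_scalingMap hβ hβ0).comp (continuous_cpMap A).continuousOn hA
  have hdual : ContinuousOn (normalizedDual A ∘ scalingMap β ∘ cpMap A) (densityMatrices n) :=
    hA.continuousOn_normalizedDual.comp hscaled fun U hU =>
      have hmem := scalingMap_mem_densityMatrices hβ hβ0 (hA U hU)
      ⟨hmem.1, ne_zero_of_mem_densityMatrices hmem⟩
  exact (continuousOn_scalingMap hα hα0).comp hdual fun _ =>
    hA.normalizedDual_scalingMap_cpMap_posDef hβ hβ0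

theorem IsPositive.bridgeMap_posDef (hA : IsPositive A) (hα : α.PosDef)
    (hβ : β.PosSemidef) (hβ0 : β ≠ 0) (hU : U ∈ densityMatrices n) : (bridgeMap A α β U).PosDef :=
  scalingMap_posDef hα (hA.normalizedDual_scalingMap_cpMap_posDef hβ hβ0 hU)

end BridgeMap

end QuantumScaling

theorem theorem4p1_general {n k : ℕ} (A : Fin k → Matrix (Fin n) (Fin n) ℂ)
    (hpos : QuantumScaling.IsPositive A) (α β : Matrix (Fin n) (Fin n) ℂ)
    (hα : α.PosSemidef) (hα0 : α ≠ 0) (hβ : β.PosSemidef) (hβ0 : β ≠ 0) :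
    Set.MapsTo (QuantumScaling.bridgeMap A α β)
      (QuantumScaling.densityMatrices n) (QuantumScaling.densityMatrices n) ∧
    ContinuousOn (QuantumScaling.bridgeMap A α β) (QuantumScaling.densityMatrices n) ∧
    (∃ U ∈ QuantumScaling.densityMatrices n, QuantumScaling.bridgeMap A α β U = U) ∧
    (α.PosDef → ∀ U ∈ QuantumScaling.densityMatrices n,
      QuantumScaling.bridgeMap A α β U = U → U.PosDef) := by
  have hmaps := hpos.mapsTo_bridgeMap hα hα0 hβ hβ0
  have hcont := hpos.continuousOn_bridgeMap hα hα0 hβ hβ0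
  refine ⟨hmaps, hcont, ?_, fun hαpos U hU hfix => ?_⟩
  · exact Brouwer.exists_fixedPoint_of_convex_isCompact QuantumScaling.convex_densityMatrices
      QuantumScaling.isCompact_densityMatrices
      ⟨_, QuantumScaling.inv_trace_smul_mem_densityMatrices hα hα0⟩ hcont hmaps
  · rw [← hfix]
    exact hpos.bridgeMap_posDef hαpos hβ hβ0 hU

theorem theorem4p1 {n k : ℕ} (A : Fin k → Matrix (Fin n) (Fin n) ℂ)
    (hQ : QuantumScaling.IsQuantumChannel A) (hpos : QuantumScaling.IsPositive A)
    (α β : Matrix (Fin n) (Fin n) ℂ)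
    (hα : α ∈ QuantumScaling.densityMatrices n) (hβ : β ∈ QuantumScaling.densityMatrices n) :
    Set.MapsTo (QuantumScaling.bridgeMap A α β)
      (QuantumScaling.densityMatrices n) (QuantumScaling.densityMatrices n) ∧
    ContinuousOn (QuantumScaling.bridgeMap A α β) (QuantumScaling.densityMatrices n) ∧
    (∃ U ∈ QuantumScaling.densityMatrices n, QuantumScaling.bridgeMap A α β U = U) ∧
    (α.PosDef → ∀ U ∈ QuantumScaling.densityMatrices n,
      QuantumScaling.bridgeMap A α β U = U → U.PosDef) :=
  theorem4p1_general A hpos α β hα.1 (QuantumScaling.ne_zero_of_mem_densityMatrices hα)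
    hβ.1 (QuantumScaling.ne_zero_of_mem_densityMatrices hβ)
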